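/- Let $M$ be a nonempty compact connected Hausdorff smooth manifold, possibly with boundary (and corners), let $\mathcal F$ be a smooth foliation of $M$ of arbitrary dimension and codimension (given by an atlas of foliated charts with values in products of a leaf model and a transverse model; along the boundary $\mathcal F$ may be tangent or transverse to it), and let $g$ be a smooth Riemannian metric on $M$ with distance $d$. A warping function is a smooth function $f:M\to(0,\infty)$ that is constant along the leaves of $\mathcal F$. The warped foliation $M_f$ is $M$ with the Riemannian distance of the metric $g_f$ given by $g_f(v,w)=f^2g(v,w)$ if $v,w$ are both tangent to $\mathcal F$, and $g_f(v,w)=g(v,w)$ if at least one of $v,w$ is $g$-orthogonal to $\mathcal F$. For leaves $L,L'$ put $\mathrm{dist}(L,L')=\inf\{d(x,y):x\in L,\ y\in L'\}$ and $$\rho(L,L')=\inf\sum_{i=1}^{k-1}\mathrm{dist}(L_i,L_{i+1}),$$ the infimum being over all finite sequences of leaves $L=L_1,\dots,L_k=L'$. The Hausdorff leaf space $\mathrm{HLS}(\mathcal F)$ is the metric space obtained from the set of leaves with the pseudo-metric $\rho$ by identifying $L$ and $L'$ whenever $\rho(L,L')=0$. Theorem. Let $G\subset M$ be a dense subset and let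 $f_n:M\to(0,1)$, $n\in\mathbb N$, be a sequence of warping functions such that $f_n(x)\to 0$ for every $x\in G$. Then the compact metric spaces $M_{f_n}$ converge in the Gromov–Hausdorff distance, and their limit is isometric to $\mathrm{HLS}(\mathcal F)$ (which is compact): $d_{GH}(M_{f_n},\mathrm{HLS}(\mathcal F))\to 0$. -/

import Mathlib

open Bundle Manifold Set Filter Topology
open scoped ContDiff ENNReal

noncomputable section

set_option linter.unusedSectionVars false

namespace FoliatedGH

section Definitions

variable {E : Type*} [NormedAddCommGroup E] [NormedSpace ℝ E]
  {H : Type*} [TopologicalSpace H] {I : ModelWithCorners ℝ E H}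
  {E₁ : Type*} [NormedAddCommGroup E₁] [NormedSpace ℝ E₁]
  {H₁ : Type*} [TopologicalSpace H₁] {I₁ : ModelWithCorners ℝ E₁ H₁}
  {E₂ : Type*} [NormedAddCommGroup E₂] [NormedSpace ℝ E₂]
  {H₂ : Type*} [TopologicalSpace H₂] {I₂ : ModelWithCorners ℝ E₂ H₂}
  {M : Type*} [TopologicalSpace M] [ChartedSpace H M]

variable (I I₁ I₂ M) in
/-- A smooth foliation of a manifold `M` (possibly with boundary and corners), given by a foliated
atlas. Foliated charts take their values in `H₁ × H₂`, the first factor being the model of the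
leaves and the second one the model of the transversals. With `I₁`, `I₂` the models of `ℝ^p`, `ℝ^q`
these are the foliations of dimension `p` and codimension `q` of manifolds without boundary; a
half space as second (first) model gives foliations tangent (transverse) to the boundary. -/
structure Foliation where
  /-- The foliated charts. -/
  atlas : Set (OpenPartialHomeomorph M (ModelProd H₁ H₂))
  exists_mem_source : ∀ x : M, ∃ φ ∈ atlas, x ∈ φ.source
  contMDiffOn : ∀ φ ∈ atlas, ContMDiffOn I (I₁.prod I₂) ∞ φ φ.source
  contMDiffOn_symm : ∀ φ ∈ atlas, ContMDiffOn (I₁.prod I₂) I ∞ φ.symm φ.target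
  /-- The image of a foliated chart is a product with connected first factor: plaques
  `φ ⁻¹ (U₁ × {c})` are connected. -/
  target_eq_prod : ∀ φ ∈ atlas, ∃ (U₁ : Set H₁) (U₂ : Set H₂),
    IsPreconnected U₁ ∧ φ.target = {z | z.1 ∈ U₁ ∧ z.2 ∈ U₂}
  /-- Changes of charts have locally the form `(x, y) ↦ (a (x, y), b y)`. -/
  compatible : ∀ φ ∈ atlas, ∀ ψ ∈ atlas, ∀ x ∈ φ.source ∩ ψ.source, ∃ W ∈ 𝓝 x,
    W ⊆ φ.source ∩ ψ.source ∧ ∀ y ∈ W, ∀ z ∈ W, (φ y).2 = (φ z).2 → (ψ y).2 = (ψ z).2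

namespace Foliation

variable (F : Foliation I I₁ I₂ M)

/-- Two points lie in a common plaque of some foliated chart. -/
def SamePlaque (x y : M) : Prop :=
  ∃ φ ∈ F.atlas, x ∈ φ.source ∧ y ∈ φ.source ∧ (φ x).2 = (φ y).2

/-- Two points lie in the same leaf if they are joined by a finite chain of plaques. -/
def leafSetoid : Setoid M := Relation.EqvGen.setoid F.SamePlaque

/-- The tangent space at `x` of the leaf through `x`: the vectors whose image under the derivative
of the transverse coordinate vanishes (this does not depend on the foliated chart around `x`). -/
def tangent (x : M) : Submodule ℝ (TangentSpace I x) :=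
  ⨅ φ ∈ F.atlas, ⨅ _ : x ∈ φ.source,
    (mfderiv I I₂ (fun y ↦ ((φ y).2 : H₂)) x).ker

/-- Warping functions: positive smooth functions on `M` that are constant along the leaves. -/
structure WarpingFunction where
  toFun : M → ℝ
  contMDiff : ContMDiff I 𝓘(ℝ) ∞ toFun
  pos : ∀ x, 0 < toFun x
  basic : ∀ x y, F.leafSetoid x y → toFun x = toFun y

instance : CoeFun F.WarpingFunction (fun _ ↦ M → ℝ) := ⟨WarpingFunction.toFun⟩

end Foliation

/-- The distance induced on `M` by a family of scalar products on the tangent spaces: the infimum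
of the lengths of the `C^1` paths between two points. -/
def metricEDist (h : RiemannianMetric (fun x : M ↦ TangentSpace I x)) (x y : M) : ℝ≥0∞ :=
  letI : RiemannianBundle (fun x : M ↦ TangentSpace I x) := ⟨h⟩
  riemannianEDist I x y

lemma metricEDist_self (h : RiemannianMetric (fun x : M ↦ TangentSpace I x)) (x : M) :
    metricEDist h x x = 0 := by
  let : RiemannianBundle (fun x : M ↦ TangentSpace I x) := ⟨h⟩
  exact riemannianEDist_self

lemma metricEDist_comm (h : RiemannianMetric (fun x : M ↦ TangentSpace I x)) (x y : M) :
    metricEDist h x y = metricEDist h y x := by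
  let : RiemannianBundle (fun x : M ↦ TangentSpace I x) := ⟨h⟩
  exact riemannianEDist_comm

lemma metricEDist_triangle [IsManifold I 1 M]
    (h : RiemannianMetric (fun x : M ↦ TangentSpace I x)) (x y z : M) :
    metricEDist h x z ≤ metricEDist h x y + metricEDist h y z := by
  let : RiemannianBundle (fun x : M ↦ TangentSpace I x) := ⟨h⟩
  exact riemannianEDist_triangle

lemma enorm_eq_sqrt (h : RiemannianMetric (fun x : M ↦ TangentSpace I x)) (x : M)
    (v : TangentSpace I x) :
    letI : RiemannianBundle (fun x : M ↦ TangentSpace I x) := ⟨h⟩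
    ‖v‖ₑ = ENNReal.ofReal (Real.sqrt (h.inner x v v)) := by
  let : RiemannianBundle (fun x : M ↦ TangentSpace I x) := ⟨h⟩
  have h1 : h.inner x v v = inner ℝ v v := rfl
  rw [h1, ← norm_eq_sqrt_real_inner, ofReal_norm]

/-- Comparison of the distances of two comparable families of scalar products. -/
lemma metricEDist_le_mul (h h' : RiemannianMetric (fun x : M ↦ TangentSpace I x)) {C : ℝ}
    (hC : 0 < C) (hle : ∀ x v, h.inner x v v ≤ C ^ 2 * h'.inner x v v) (x y : M) :
    metricEDist h x y ≤ ENNReal.ofReal C * metricEDist h' x y := by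
  have key : ∀ (z : M) (v : TangentSpace I z),
      ENNReal.ofReal (Real.sqrt (h.inner z v v)) ≤
        ENNReal.ofReal C * ENNReal.ofReal (Real.sqrt (h'.inner z v v)) := by
    intro z v
    rw [← ENNReal.ofReal_mul hC.le]
    apply ENNReal.ofReal_le_ofReal
    calc Real.sqrt (h.inner z v v) ≤ Real.sqrt (C ^ 2 * h'.inner z v v) :=
          Real.sqrt_le_sqrt (hle z v)
      _ = C * Real.sqrt (h'.inner z v v) := by
          rw [Real.sqrt_mul (sq_nonneg C), Real.sqrt_sq hC.le]
  unfold metricEDist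
  simp only [riemannianEDist, enorm_eq_sqrt]
  have h0 : ENNReal.ofReal C ≠ 0 := (ENNReal.ofReal_pos.2 hC).ne'
  simp only [ENNReal.mul_iInf_of_ne h0 ENNReal.ofReal_ne_top]
  refine le_iInf₂ fun γ hγ ↦ (iInf₂_le γ hγ).trans ?_
  rw [← MeasureTheory.lintegral_const_mul' _ _ ENNReal.ofReal_ne_top]
  exact MeasureTheory.lintegral_mono fun t ↦ key _ _

variable [IsManifold I ∞ M]

section Distance

variable (g : ContMDiffRiemannianMetric I ∞ E (fun x : M ↦ TangentSpace I x))

/-- The Riemannian distance of `(M, g)`. -/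
def gEDist (x y : M) : ℝ≥0∞ := metricEDist g.toRiemannianMetric x y

lemma eventually_gEDist_lt (x : M) {c : ℝ≥0∞} (hc : 0 < c) : ∀ᶠ y in 𝓝 x, gEDist g x y < c := by
  let : RiemannianBundle (fun x : M ↦ TangentSpace I x) := ⟨g.toRiemannianMetric⟩
  have : IsContinuousRiemannianBundle E (fun x : M ↦ TangentSpace I x) :=
    ⟨g.inner, g.contMDiff.continuous, fun _ _ _ ↦ rfl⟩
  exact eventually_riemannianEDist_lt I x hc

lemma eq_of_gEDist_eq_zero [T2Space M] [CompactSpace M] {x y : M} (h : gEDist g x y = 0) :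
    x = y := by
  let : RiemannianBundle (fun x : M ↦ TangentSpace I x) := ⟨g.toRiemannianMetric⟩
  have : IsContinuousRiemannianBundle E (fun x : M ↦ TangentSpace I x) :=
    ⟨g.inner, g.contMDiff.continuous, fun _ _ _ ↦ rfl⟩
  by_contra hne
  obtain ⟨c, hc, hsub⟩ := setOfPred_riemannianEDist_lt_subset_nhds' I
    (isOpen_compl_singleton.mem_nhds (show x ∈ ({y} : Set M)ᶜ from hne))
  have h' : riemannianEDist I x y = 0 := h
  have hy : y ∈ {z | riemannianEDist I x z < c} := by
    rw [mem_ofPred_eq, h']; exact hc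
  exact hsub hy rfl

lemma gEDist_ne_top [ConnectedSpace M] (x y : M) : gEDist g x y ≠ ⊤ := by
  have hcl : IsClopen {z | gEDist g x z ≠ ⊤} := by
    constructor
    · rw [← isOpen_compl_iff, isOpen_iff_mem_nhds]
      intro z hz
      have hz' : gEDist g x z = ⊤ := by simpa using hz
      filter_upwards [eventually_gEDist_lt g z one_pos] with w hw
      have h := metricEDist_triangle g.toRiemannianMetric x w z
      rw [metricEDist_comm _ w z] at h
      simp only [mem_compl_iff, mem_ofPred_eq, not_not]
      by_contra hne
      have : gEDist g x z < ⊤ := h.trans_lt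
        (ENNReal.add_lt_top.2 ⟨lt_top_iff_ne_top.2 hne, hw.trans ENNReal.one_lt_top⟩)
      exact this.ne hz'
    · rw [isOpen_iff_mem_nhds]
      intro z hz
      filter_upwards [eventually_gEDist_lt g z one_pos] with w hw
      have h := metricEDist_triangle g.toRiemannianMetric x z w
      exact (h.trans_lt (ENNReal.add_lt_top.2 ⟨lt_top_iff_ne_top.2 hz,
        hw.trans ENNReal.one_lt_top⟩)).ne
  have hx : x ∈ {z | gEDist g x z ≠ ⊤} := by simp [gEDist, metricEDist_self]
  have : y ∈ {z | gEDist g x z ≠ ⊤} := by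
    rw [hcl.eq_univ ⟨x, hx⟩]; trivial
  exact this

/-- A Lipschitz image of a compact Riemannian manifold is compact. -/
lemma compactSpace_of_edist_le [CompactSpace M] {X : Type*} [PseudoEMetricSpace X] (p : M → X)
    (hp : Function.Surjective p) {C : ℝ}
    (hle : ∀ x y, edist (p x) (p y) ≤ ENNReal.ofReal C * gEDist g x y) : CompactSpace X := by
  have hcont : Continuous p := by
    rw [continuous_iff_continuousAt]
    intro x
    rw [ContinuousAt, EMetric.tendsto_nhds]
    intro ε hε
    filter_upwards [eventually_gEDist_lt g x (ENNReal.div_pos hε.ne' ENNReal.ofReal_ne_top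
      (b := ENNReal.ofReal C))] with y hy
    rw [edist_comm]
    refine (hle x y).trans_lt ?_
    rw [mul_comm]
    exact ENNReal.mul_lt_of_lt_div hy
  exact hp.compactSpace hcont

end Distance

namespace Foliation

variable (F : Foliation I I₁ I₂ M)
  (g : ContMDiffRiemannianMetric I ∞ E (fun x : M ↦ TangentSpace I x))

/-! ### The Hausdorff leaf space -/

/-- The space of leaves. -/
@[nolint unusedArguments]
def LeafSpace (_g : ContMDiffRiemannianMetric I ∞ E (fun x : M ↦ TangentSpace I x)) : Type _ :=
  Quotient F.leafSetoid

variable {F g}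

/-- The leaf through a point. -/
def leafOf (x : M) : F.LeafSpace g := Quotient.mk F.leafSetoid x

lemma leafOf_surjective : Function.Surjective (leafOf : M → F.LeafSpace g) := Quotient.mk_surjective

/-- The distance `dist (L, L')` of two leaves as subsets of `M`. -/
def leafDist (L L' : F.LeafSpace g) : ℝ≥0∞ :=
  ⨅ (x : M) (y : M) (_ : leafOf x = L) (_ : leafOf y = L'), gEDist g x y

/-- The infimum of `∑ dist (L_i, L_{i+1})` over all finite sequences of leaves from `L` to `L'`. -/
def rho (L L' : F.LeafSpace g) : ℝ≥0∞ :=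
  ⨅ (n : ℕ) (c : ℕ → F.LeafSpace g) (_ : c 0 = L) (_ : c n = L'),
    ∑ i ∈ Finset.range n, leafDist (c i) (c (i + 1))

lemma leafDist_comm (L L' : F.LeafSpace g) : leafDist L L' = leafDist L' L := by
  have h : ∀ L L' : F.LeafSpace g, leafDist L L' ≤ leafDist L' L := by
    intro L L'
    refine le_iInf₂ fun x y ↦ le_iInf₂ fun hx hy ↦ ?_
    refine (iInf₂_le y x).trans ((iInf₂_le hy hx).trans ?_)
    exact (metricEDist_comm _ _ _).le
  exact le_antisymm (h _ _) (h _ _)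

lemma leafDist_le (x y : M) : leafDist (leafOf x : F.LeafSpace g) (leafOf y) ≤ gEDist g x y :=
  (iInf₂_le x y).trans ((iInf_le _ rfl).trans (iInf_le _ rfl))

lemma rho_le_sum (n : ℕ) (c : ℕ → F.LeafSpace g) :
    rho (c 0) (c n) ≤ ∑ i ∈ Finset.range n, leafDist (c i) (c (i + 1)) :=
  (iInf₂_le n c).trans ((iInf_le _ rfl).trans (iInf_le _ rfl))

lemma rho_self (L : F.LeafSpace g) : rho L L = 0 :=
  le_antisymm ((rho_le_sum 0 (fun _ ↦ L)).trans (by simp)) bot_le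

lemma rho_le_leafDist (L L' : F.LeafSpace g) : rho L L' ≤ leafDist L L' := by
  simpa using rho_le_sum 1 (fun i ↦ if i = 0 then L else L')

lemma rho_comm (L L' : F.LeafSpace g) : rho L L' = rho L' L := by
  have h : ∀ L L' : F.LeafSpace g, rho L L' ≤ rho L' L := by
    intro L L'
    refine le_iInf₂ fun n c ↦ le_iInf₂ fun h0 hn ↦ ?_
    have h := rho_le_sum n (fun i ↦ c (n - i))
    simp only [Nat.sub_zero, Nat.sub_self, h0, hn] at h
    refine h.trans (le_of_eq ?_)
    rw [← Finset.sum_range_reflect]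
    refine Finset.sum_congr rfl fun i hi ↦ ?_
    have hi' := Finset.mem_range.1 hi
    rw [leafDist_comm]
    congr 2 <;> omega
  exact le_antisymm (h _ _) (h _ _)

lemma rho_triangle (L L' L'' : F.LeafSpace g) : rho L L'' ≤ rho L L' + rho L' L'' := by
  rw [rho.eq_1 L L', rho.eq_1 L' L'']
  simp only [ENNReal.iInf_add, ENNReal.add_iInf]
  refine le_iInf₂ fun m d ↦ le_iInf₂ fun h0' hm ↦ le_iInf₂ fun n c ↦ le_iInf₂ fun h0 hn ↦ ?_
  have h := rho_le_sum (n + m) (fun i ↦ if i ≤ n then c i else d (i - n))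
  have hend : (if n + m ≤ n then c (n + m) else d (n + m - n)) = L'' := by
    rcases Nat.eq_zero_or_pos m with rfl | hpos
    · rw [← hm, h0']
      simpa using hn
    · rw [if_neg (by omega), Nat.add_sub_cancel_left, hm]
  simp only [Nat.zero_le, if_true, h0, hend] at h
  refine h.trans (le_of_eq ?_)
  rw [Finset.sum_range_add]
  congr 1
  · refine Finset.sum_congr rfl fun i hi ↦ ?_
    have hi' := Finset.mem_range.1 hi
    rw [if_pos (by omega), if_pos (by omega)]
  · refine Finset.sum_congr rfl fun i _ ↦ ?_
    have e : n + i + 1 - n = i + 1 := by omega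
    rw [if_neg (show ¬ n + i + 1 ≤ n by omega), e]
    rcases Nat.eq_zero_or_pos i with rfl | hpos
    · simp [hn, h0']
    · rw [if_neg (by omega), Nat.add_sub_cancel_left]

variable (F g)

/-- The pseudo-metric `ρ` on the space of leaves. -/
instance [ConnectedSpace M] : PseudoMetricSpace (F.LeafSpace g) :=
  letI : PseudoEMetricSpace (F.LeafSpace g) :=
    { edist := rho
      edist_self := rho_self
      edist_comm := rho_comm
      edist_triangle := rho_triangle }
  PseudoEMetricSpace.toPseudoMetricSpace fun L L' ↦ by
    obtain ⟨x, rfl⟩ := leafOf_surjective L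
    obtain ⟨y, rfl⟩ := leafOf_surjective L'
    exact (((rho_le_leafDist _ _).trans (leafDist_le x y)).trans_lt
      (lt_top_iff_ne_top.2 (gEDist_ne_top g _ _))).ne

lemma LeafSpace.edist_eq [ConnectedSpace M] (L L' : F.LeafSpace g) : edist L L' = rho L L' := rfl

/-- The Hausdorff leaf space: the metric space obtained from the space of leaves, with the
pseudo-metric `ρ`, by identifying the leaves `L`, `L'` with `ρ (L, L') = 0`. -/
def HausdorffLeafSpace [ConnectedSpace M] : Type _ := SeparationQuotient (F.LeafSpace g)

section

variable [ConnectedSpace M]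

instance : MetricSpace (F.HausdorffLeafSpace g) :=
  inferInstanceAs (MetricSpace (SeparationQuotient (F.LeafSpace g)))

variable {F g} in
/-- The class of a leaf. -/
def LeafSpace.toHausdorff (L : F.LeafSpace g) : F.HausdorffLeafSpace g := SeparationQuotient.mk L

lemma edist_toHausdorff (L L' : F.LeafSpace g) :
    edist L.toHausdorff L'.toHausdorff = rho L L' := SeparationQuotient.edist_mk L L'

lemma toHausdorff_eq_iff (L L' : F.LeafSpace g) :
    L.toHausdorff = L'.toHausdorff ↔ rho L L' = 0 := by
  rw [← edist_toHausdorff, edist_eq_zero]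

lemma toHausdorff_surjective :
    Function.Surjective (LeafSpace.toHausdorff : F.LeafSpace g → F.HausdorffLeafSpace g) :=
  SeparationQuotient.surjective_mk

instance : Nonempty (F.HausdorffLeafSpace g) :=
  ⟨(leafOf (Classical.arbitrary M) : F.LeafSpace g).toHausdorff⟩

instance [CompactSpace M] : CompactSpace (F.HausdorffLeafSpace g) := by
  refine compactSpace_of_edist_le g (X := F.HausdorffLeafSpace g)
    (fun x : M ↦ (leafOf x : F.LeafSpace g).toHausdorff)
    ((toHausdorff_surjective F g).comp leafOf_surjective) (C := 1) fun x y ↦ ?_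
  rw [edist_toHausdorff, ENNReal.ofReal_one, one_mul]
  exact (rho_le_leafDist _ _).trans (leafDist_le x y)

end

/-! ### Warped foliations -/

variable [FiniteDimensional ℝ E]

/-- The `g`-orthogonal projection onto the tangent space of the leaf through `x`. -/
def tangentProj (x : M) : TangentSpace I x →L[ℝ] TangentSpace I x :=
  letI : RiemannianBundle (fun x : M ↦ TangentSpace I x) := ⟨g.toRiemannianMetric⟩
  haveI : FiniteDimensional ℝ (TangentSpace I x) := inferInstanceAs (FiniteDimensional ℝ E)
  (F.tangent x).starProjection

/-- The scalar product `g_f (v, w) = f ^ 2 * g (v^⊤, w^⊤) + g (v^⊥, w^⊥)` on `T_x M`. -/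
def warpedInner (f : F.WarpingFunction) (x : M) :
    TangentSpace I x →L[ℝ] TangentSpace I x →L[ℝ] ℝ :=
  letI : RiemannianBundle (fun x : M ↦ TangentSpace I x) := ⟨g.toRiemannianMetric⟩
  letI P : TangentSpace I x →L[ℝ] TangentSpace I x := F.tangentProj g x
  letI Q : TangentSpace I x →L[ℝ] TangentSpace I x := ContinuousLinearMap.id ℝ _ - P
  (f x) ^ 2 • (g.inner x).bilinearComp P P + (g.inner x).bilinearComp Q Q

variable {F g}

lemma tangentProj_mem (x : M) (v : TangentSpace I x) : F.tangentProj g x v ∈ F.tangent x := by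
  let : RiemannianBundle (fun x : M ↦ TangentSpace I x) := ⟨g.toRiemannianMetric⟩
  have : FiniteDimensional ℝ (TangentSpace I x) := inferInstanceAs (FiniteDimensional ℝ E)
  exact Submodule.starProjection_apply_mem (F.tangent x) v

lemma tangentProj_of_mem {x : M} {v : TangentSpace I x} (hv : v ∈ F.tangent x) :
    F.tangentProj g x v = v := by
  let : RiemannianBundle (fun x : M ↦ TangentSpace I x) := ⟨g.toRiemannianMetric⟩
  have : FiniteDimensional ℝ (TangentSpace I x) := inferInstanceAs (FiniteDimensional ℝ E)
  exact Submodule.starProjection_eq_self_iff.2 hv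

lemma tangentProj_of_perp {x : M} {v : TangentSpace I x}
    (hv : ∀ w ∈ F.tangent x, g.inner x w v = 0) : F.tangentProj g x v = 0 := by
  let : RiemannianBundle (fun x : M ↦ TangentSpace I x) := ⟨g.toRiemannianMetric⟩
  have : FiniteDimensional ℝ (TangentSpace I x) := inferInstanceAs (FiniteDimensional ℝ E)
  have h : v ∈ (F.tangent x)ᗮ := fun w hw ↦ hv w hw
  exact (Submodule.starProjection_apply_eq_zero_iff (F.tangent x)).2 h

lemma inner_tangentProj_sub (x : M) {w : TangentSpace I x} (hw : w ∈ F.tangent x)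
    (v : TangentSpace I x) : g.inner x w (v - F.tangentProj g x v) = 0 := by
  let : RiemannianBundle (fun x : M ↦ TangentSpace I x) := ⟨g.toRiemannianMetric⟩
  have : FiniteDimensional ℝ (TangentSpace I x) := inferInstanceAs (FiniteDimensional ℝ E)
  have h := Submodule.sub_starProjection_mem_orthogonal (K := F.tangent x) v
  exact h w hw

lemma inner_eq_add (x : M) (v w : TangentSpace I x) :
    g.inner x v w = g.inner x (F.tangentProj g x v) (F.tangentProj g x w) +
      g.inner x (v - F.tangentProj g x v) (w - F.tangentProj g x w) := by
  have h1 := inner_tangentProj_sub (F := F) (g := g) x (tangentProj_mem (g := g) x v) w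
  have h2 := inner_tangentProj_sub (F := F) (g := g) x (tangentProj_mem (g := g) x w) v
  rw [g.symm] at h2
  simp only [map_sub, sub_apply] at h1 h2 ⊢
  linarith

lemma warpedInner_apply (f : F.WarpingFunction) (x : M) (v w : TangentSpace I x) :
    F.warpedInner g f x v w =
      (f x) ^ 2 * g.inner x (F.tangentProj g x v) (F.tangentProj g x w) +
        g.inner x (v - F.tangentProj g x v) (w - F.tangentProj g x w) := rfl

/-- `g_f (v, w) = f ^ 2 * g (v, w)` if both vectors are tangent to the foliation. -/
lemma warpedInner_of_mem (f : F.WarpingFunction) {x : M} {v w : TangentSpace I x}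
    (hv : v ∈ F.tangent x) (hw : w ∈ F.tangent x) :
    F.warpedInner g f x v w = (f x) ^ 2 * g.inner x v w := by
  simp [warpedInner_apply, tangentProj_of_mem hv, tangentProj_of_mem hw]

/-- `g_f (v, w) = g (v, w)` if one of the vectors is orthogonal to the foliation. -/
lemma warpedInner_of_perp (f : F.WarpingFunction) {x : M} (v : TangentSpace I x)
    {w : TangentSpace I x} (hw : ∀ u ∈ F.tangent x, g.inner x u w = 0) :
    F.warpedInner g f x v w = g.inner x v w := by
  rw [warpedInner_apply, inner_eq_add (F := F) x v w]
  simp [tangentProj_of_perp hw]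

lemma inner_self_nonneg (x : M) (v : TangentSpace I x) : 0 ≤ g.inner x v v := by
  rcases eq_or_ne v 0 with rfl | hv
  · simp
  · exact (g.pos x v hv).le

lemma warpedInner_le (f : F.WarpingFunction) (x : M) (v : TangentSpace I x) {C : ℝ}
    (h1 : 1 ≤ C) (hf : f x ≤ C) : F.warpedInner g f x v v ≤ C ^ 2 * g.inner x v v := by
  rw [warpedInner_apply, inner_eq_add (F := F) x v v]
  have := f.pos x
  have hP := inner_self_nonneg (g := g) x (F.tangentProj g x v)
  have hQ := inner_self_nonneg (g := g) x (v - F.tangentProj g x v)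
  have h2 : (f x) ^ 2 ≤ C ^ 2 := by gcongr
  have h3 : 1 ≤ C ^ 2 := one_le_pow₀ h1
  nlinarith [mul_nonneg (sub_nonneg.2 h2) hP, mul_nonneg (sub_nonneg.2 h3) hQ]

lemma le_warpedInner (f : F.WarpingFunction) (x : M) (v : TangentSpace I x) {C : ℝ}
    (h1 : 1 ≤ C) (hf : 1 ≤ C * f x) : g.inner x v v ≤ C ^ 2 * F.warpedInner g f x v v := by
  rw [warpedInner_apply, inner_eq_add (F := F) x v v]
  have := f.pos x
  have hP := inner_self_nonneg (g := g) x (F.tangentProj g x v)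
  have hQ := inner_self_nonneg (g := g) x (v - F.tangentProj g x v)
  have h2 : 1 ≤ (C * f x) ^ 2 := one_le_pow₀ hf
  have h3 : 1 ≤ C ^ 2 := one_le_pow₀ h1
  rw [mul_pow] at h2
  nlinarith [mul_nonneg (sub_nonneg.2 h2) hP, mul_nonneg (sub_nonneg.2 h3) hQ]

variable (F g)

/-- The warped Riemannian structure `g_f`. -/
def warpedMetric (f : F.WarpingFunction) : RiemannianMetric (fun x : M ↦ TangentSpace I x) where
  inner := F.warpedInner g f
  symm x v w := by
    rw [warpedInner_apply, warpedInner_apply, g.symm x (F.tangentProj g x v),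
      g.symm x (v - F.tangentProj g x v)]
  pos x v hv := by
    have h0 := f.pos x
    have h := le_warpedInner (g := g) f x v (C := max 1 (1 / f x)) (le_max_left _ _)
      ((div_le_iff₀ h0).1 (le_max_right _ _))
    have h1 := g.pos x v hv
    by_contra hneg
    nlinarith [sq_nonneg (max 1 (1 / f x))]
  continuousAt x := by
    let : RiemannianBundle (fun x : M ↦ TangentSpace I x) := ⟨g.toRiemannianMetric⟩
    have : Continuous (fun v : TangentSpace I x ↦ F.warpedInner g f x v v) := by fun_prop
    exact this.continuousAt
  isVonNBounded x := by
    let : RiemannianBundle (fun x : M ↦ TangentSpace I x) := ⟨g.toRiemannianMetric⟩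
    have h0 := f.pos x
    set C := max 1 (1 / f x)
    have hC : 0 < C := lt_of_lt_of_le one_pos (le_max_left _ _)
    refine (NormedSpace.isVonNBounded_ball ℝ (TangentSpace I x) C).subset fun v hv ↦ ?_
    have h := le_warpedInner (g := g) f x v (C := C) (le_max_left _ _)
      ((div_le_iff₀ h0).1 (le_max_right _ _))
    have h1 : F.warpedInner g f x v v < 1 := hv
    have h2 : ‖v‖ ^ 2 = g.inner x v v := (real_inner_self_eq_norm_sq v).symm
    rw [mem_ball_zero_iff]
    refine lt_of_pow_lt_pow_left₀ 2 hC.le ?_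
    nlinarith [sq_pos_of_pos hC]

/-- The warped foliation `M_f`: the manifold `M` with the distance of `g_f`. -/
@[nolint unusedArguments]
def Warped (_g : ContMDiffRiemannianMetric I ∞ E (fun x : M ↦ TangentSpace I x))
    (_f : F.WarpingFunction) : Type _ := M

variable {F} in
/-- The distance of `M_f`. -/
def warpedEDist (f : F.WarpingFunction) (x y : M) : ℝ≥0∞ := metricEDist (F.warpedMetric g f) x y

variable {F} in
lemma exists_bounds [CompactSpace M] [Nonempty M] (f : F.WarpingFunction) :
    ∃ C : ℝ, 1 ≤ C ∧ ∀ x, f x ≤ C ∧ 1 ≤ C * f x := by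
  have hcont : Continuous f := f.contMDiff.continuous
  obtain ⟨a, -, ha⟩ := isCompact_univ.exists_isMinOn univ_nonempty hcont.continuousOn
  obtain ⟨b, -, hb⟩ := isCompact_univ.exists_isMaxOn univ_nonempty hcont.continuousOn
  have h0 := f.pos a
  refine ⟨max 1 (max (f b) (1 / f a)), le_max_left _ _, fun x ↦ ⟨?_, ?_⟩⟩
  · exact (hb (mem_univ x)).trans ((le_max_left _ _).trans (le_max_right _ _))
  · have hax : f a ≤ f x := ha (mem_univ x)
    have h1 : 1 / f a ≤ max 1 (max (f b) (1 / f a)) := (le_max_right _ _).trans (le_max_right _ _)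
    rw [div_le_iff₀ h0] at h1
    refine h1.trans ?_
    gcongr

variable {F} in
lemma exists_warpedEDist_bounds [CompactSpace M] [Nonempty M] (f : F.WarpingFunction) :
    ∃ C : ℝ, 0 < C ∧ ∀ x y, warpedEDist g f x y ≤ ENNReal.ofReal C * gEDist g x y ∧
      gEDist g x y ≤ ENNReal.ofReal C * warpedEDist g f x y := by
  obtain ⟨C, hC, h⟩ := exists_bounds f
  have hC0 : 0 < C := lt_of_lt_of_le one_pos hC
  refine ⟨C, hC0, fun x y ↦ ⟨?_, ?_⟩⟩
  · exact metricEDist_le_mul _ _ hC0 (fun z v ↦ warpedInner_le f z v hC (h z).1) x y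
  · exact metricEDist_le_mul _ _ hC0 (fun z v ↦ le_warpedInner f z v hC (h z).2) x y

section

variable [T2Space M] [CompactSpace M] [ConnectedSpace M] (f : F.WarpingFunction)

instance : MetricSpace (F.Warped g f) :=
  letI : EMetricSpace (F.Warped g f) :=
    { edist := fun x y ↦ warpedEDist g f x y
      edist_self := fun x ↦ metricEDist_self (F.warpedMetric g f) (x : M)
      edist_comm := fun x y ↦ metricEDist_comm (F.warpedMetric g f) (x : M) y
      edist_triangle := fun x y z ↦ metricEDist_triangle (F.warpedMetric g f) (x : M) y z
      eq_of_edist_eq_zero := by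
        intro x y h
        obtain ⟨C, -, hC⟩ := exists_warpedEDist_bounds g f
        refine eq_of_gEDist_eq_zero g (le_antisymm ((hC x y).2.trans ?_) bot_le)
        have h' : warpedEDist g f x y = 0 := h
        simp [h'] }
  EMetricSpace.toMetricSpace fun x y ↦ by
    obtain ⟨C, -, hC⟩ := exists_warpedEDist_bounds g f
    exact ((hC x y).1.trans_lt (ENNReal.mul_lt_top ENNReal.ofReal_lt_top
      (lt_top_iff_ne_top.2 (gEDist_ne_top g _ _)))).ne

lemma Warped.edist_eq (x y : F.Warped g f) : edist x y = warpedEDist g f x y := rfl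

instance : Nonempty (F.Warped g f) := inferInstanceAs (Nonempty M)

instance : CompactSpace (F.Warped g f) := by
  obtain ⟨C, -, hC⟩ := exists_warpedEDist_bounds g f
  exact compactSpace_of_edist_le g (X := F.Warped g f) (fun x : M ↦ x) (fun x ↦ ⟨x, rfl⟩)
    (fun x y ↦ (hC x y).1)

end

end Foliation
end Definitions
end FoliatedGH
end

noncomputable section

namespace FoliatedGH

section ModelSpaces

variable {E : Type*} [NormedAddCommGroup E] [NormedSpace ℝ E]
  {H : Type*} [TopologicalSpace H] {I : ModelWithCorners ℝ E H}
  {E₁ : Type*} [NormedAddCommGroup E₁] [NormedSpace ℝ E₁]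
  {H₁ : Type*} [TopologicalSpace H₁] {I₁ : ModelWithCorners ℝ E₁ H₁}
  {E₂ : Type*} [NormedAddCommGroup E₂] [NormedSpace ℝ E₂]
  {H₂ : Type*} [TopologicalSpace H₂] {I₂ : ModelWithCorners ℝ E₂ H₂}
  {M : Type*} [TopologicalSpace M] [ChartedSpace H M]

lemma contMDiff_modelProd_snd {n : ℕ∞ω} :
    ContMDiff (I₁.prod I₂) I₂ n (fun z : ModelProd H₁ H₂ ↦ z.2) := by
  have h : ContMDiff (I₁.prod I₂) I₂ n (Prod.snd : H₁ × H₂ → H₂) := contMDiff_snd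
  rw [chartedSpaceSelf_prod] at h
  exact h

lemma mfderiv_modelProd_snd (z : ModelProd H₁ H₂) :
    mfderiv (I₁.prod I₂) I₂ (fun z : ModelProd H₁ H₂ ↦ z.2) z =
      ContinuousLinearMap.snd ℝ E₁ E₂ := by
  have h : (letI : ChartedSpace (ModelProd H₁ H₂) (H₁ × H₂) := prodChartedSpace H₁ H₁ H₂ H₂
      mfderiv (M := H₁ × H₂) (I₁.prod I₂) I₂ Prod.snd z : E₁ × E₂ →L[ℝ] E₂) =
    ContinuousLinearMap.snd ℝ E₁ E₂ := mfderiv_snd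
  rw [chartedSpaceSelf_prod] at h
  exact h

lemma contMDiffOn_modelProdMk {n : ℕ∞ω} {c : M → H₁} {b : M → H₂} {s : Set M}
    (hc : ContMDiffOn I I₁ n c s) (hb : ContMDiffOn I I₂ n b s) :
    ContMDiffOn (M' := ModelProd H₁ H₂) I (I₁.prod I₂) n (fun t ↦ (c t, b t)) s := by
  have h : ContMDiffOn I (I₁.prod I₂) n (fun t ↦ ((c t, b t) : H₁ × H₂)) s := hc.prodMk hb
  rw [chartedSpaceSelf_prod] at h
  exact h

/-- The derivative of a curve in a model space is the derivative of its coordinates. -/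
lemma mfderiv_eq_fderiv_model {γ : ℝ → H} {t : ℝ} (h : MDifferentiableAt 𝓘(ℝ, ℝ) I γ t) :
    mfderiv 𝓘(ℝ, ℝ) I γ t = fderiv ℝ (I ∘ γ) t := by
  simp only [mfderiv, h, writtenInExtChartAt, mfld_simps, fderivWithin_univ]
  rfl

end ModelSpaces

section Curves

variable {E : Type*} [NormedAddCommGroup E] [NormedSpace ℝ E]
  {H : Type*} [TopologicalSpace H] {I : ModelWithCorners ℝ E H}
  {M : Type*} [TopologicalSpace M] [ChartedSpace H M]

variable (I) in
/-- The velocity of a curve in a manifold. -/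
def velocity (γ : ℝ → M) (t : ℝ) : TangentSpace I (γ t) := mfderiv 𝓘(ℝ, ℝ) I γ t (1 : ℝ)

/-- The norm of a tangent vector with respect to a family of scalar products. -/
def tnorm (h : RiemannianMetric (fun x : M ↦ TangentSpace I x)) (x : M) (v : TangentSpace I x) :
    ℝ := √(h.inner x v v)

lemma metricEDist_le_lintegral (h : RiemannianMetric (fun x : M ↦ TangentSpace I x))
    {γ : ℝ → M} {a b : ℝ} (hγ : ContMDiffOn 𝓘(ℝ, ℝ) I 1 γ (Icc a b)) (hab : a ≤ b) :
    metricEDist h (γ a) (γ b) ≤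
      ∫⁻ t in Ioo a b, ENNReal.ofReal (tnorm h (γ t) (velocity I γ t)) := by
  let : RiemannianBundle (fun x : M ↦ TangentSpace I x) := ⟨h⟩
  refine (riemannianEDist_le_pathELength hγ rfl rfl hab).trans (le_of_eq ?_)
  rw [pathELength_eq_lintegral_mfderiv_Ioo]
  exact MeasureTheory.lintegral_congr fun t ↦ enorm_eq_sqrt h _ _

lemma exists_curve_of_metricEDist_lt (h : RiemannianMetric (fun x : M ↦ TangentSpace I x))
    {x y : M} {r : ℝ≥0∞} (hr : metricEDist h x y < r) :
    ∃ γ : ℝ → M, γ 0 = x ∧ γ 1 = y ∧ ContMDiff 𝓘(ℝ, ℝ) I 1 γ ∧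
      ∫⁻ t in Ioo (0 : ℝ) 1, ENNReal.ofReal (tnorm h (γ t) (velocity I γ t)) < r := by
  let : RiemannianBundle (fun x : M ↦ TangentSpace I x) := ⟨h⟩
  obtain ⟨γ, h0, h1, hγ, hlt, -⟩ :=
    exists_lt_locally_constant_of_riemannianEDist_lt hr (zero_lt_one' ℝ)
  refine ⟨γ, h0, h1, hγ, lt_of_eq_of_lt ?_ hlt⟩
  rw [pathELength_eq_lintegral_mfderiv_Ioo]
  exact MeasureTheory.lintegral_congr fun t ↦ (enorm_eq_sqrt h _ _).symm

lemma metricEDist_le_of_tnorm_le (h : RiemannianMetric (fun x : M ↦ TangentSpace I x))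
    {γ : ℝ → M} {a b C : ℝ} (hγ : ContMDiffOn 𝓘(ℝ, ℝ) I 1 γ (Icc a b)) (hab : a ≤ b)
    (hC : ∀ t ∈ Ioo a b, tnorm h (γ t) (velocity I γ t) ≤ C) :
    metricEDist h (γ a) (γ b) ≤ ENNReal.ofReal C * ENNReal.ofReal (b - a) := by
  refine (metricEDist_le_lintegral h hγ hab).trans ?_
  refine (MeasureTheory.setLIntegral_mono' measurableSet_Ioo
    fun t ht ↦ ENNReal.ofReal_le_ofReal (hC t ht)).trans (le_of_eq ?_)
  simp

variable [IsManifold I ∞ M] (g : ContMDiffRiemannianMetric I ∞ E (fun x : M ↦ TangentSpace I x))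

lemma continuous_tnorm :
    Continuous (fun p : TangentBundle I M ↦ tnorm g.toRiemannianMetric p.proj p.2) := by
  let : RiemannianBundle (fun x : M ↦ TangentSpace I x) := ⟨g.toRiemannianMetric⟩
  have : IsContinuousRiemannianBundle E (fun x : M ↦ TangentSpace I x) :=
    ⟨g.inner, g.contMDiff.continuous, fun _ _ _ ↦ rfl⟩
  exact (Continuous.inner_bundle (F := E) (E := fun x : M ↦ TangentSpace I x)
    (b := fun p : TangentBundle I M ↦ p.proj) (v := fun p ↦ p.2) (w := fun p ↦ p.2)
    continuous_id continuous_id).sqrt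

lemma continuousOn_tnorm_velocity {γ : ℝ → M} {s : Set ℝ} (hs : UniqueDiffOn ℝ s)
    (hγ : ContMDiffOn 𝓘(ℝ, ℝ) I 1 γ s) :
    ContinuousOn (fun t ↦ tnorm g.toRiemannianMetric (γ t)
      (mfderivWithin 𝓘(ℝ, ℝ) I γ s t (1 : ℝ))) s := by
  have h1 := hγ.continuousOn_tangentMapWithin le_rfl hs.uniqueMDiffOn
  have h2 : Continuous (fun t : ℝ ↦ (⟨t, (1 : ℝ)⟩ : TangentBundle 𝓘(ℝ, ℝ) ℝ)) :=
    (tangentBundleModelSpaceHomeomorph 𝓘(ℝ, ℝ)).symm.continuous.comp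
      (continuous_id.prodMk continuous_const : Continuous (fun t : ℝ ↦ (t, (1 : ℝ))))
  exact (continuous_tnorm g).comp_continuousOn (h1.comp h2.continuousOn fun t ht ↦ ht)

lemma exists_tnorm_velocity_le {γ : ℝ → M} {a b : ℝ} (hab : a < b)
    (hγ : ContMDiffOn 𝓘(ℝ, ℝ) I 1 γ (Icc a b)) :
    ∃ C : ℝ, 0 ≤ C ∧ ∀ t ∈ Ioo a b, tnorm g.toRiemannianMetric (γ t) (velocity I γ t) ≤ C := by
  obtain ⟨C, hC⟩ := (isCompact_Icc.image_of_continuousOn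
    (continuousOn_tnorm_velocity g (uniqueDiffOn_Icc hab) hγ)).bddAbove
  refine ⟨max C 0, le_max_right _ _, fun t ht ↦ le_max_of_le_left ?_⟩
  have := hC (mem_image_of_mem _ (Ioo_subset_Icc_self ht))
  rwa [mfderivWithin_of_mem_nhds (Icc_mem_nhds ht.1 ht.2)] at this

lemma continuousAt_tnorm_velocity {γ : ℝ → M} {s : Set ℝ} {t : ℝ} (hs : s ∈ 𝓝 t)
    (hγ : ContMDiffOn 𝓘(ℝ, ℝ) I 1 γ s) :
    ContinuousAt (fun t ↦ tnorm g.toRiemannianMetric (γ t) (velocity I γ t)) t := by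
  have ht : t ∈ interior s := mem_interior_iff_mem_nhds.2 hs
  have h := (continuousOn_tnorm_velocity g isOpen_interior.uniqueDiffOn
    (hγ.mono interior_subset)).continuousAt (isOpen_interior.mem_nhds ht)
  refine h.congr ?_
  filter_upwards [isOpen_interior.mem_nhds ht] with u hu
  rw [mfderivWithin_of_isOpen isOpen_interior hu]
  rfl

end Curves

section Leaves

variable {E : Type*} [NormedAddCommGroup E] [NormedSpace ℝ E]
  {H : Type*} [TopologicalSpace H] {I : ModelWithCorners ℝ E H}
  {E₁ : Type*} [NormedAddCommGroup E₁] [NormedSpace ℝ E₁]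
  {H₁ : Type*} [TopologicalSpace H₁] {I₁ : ModelWithCorners ℝ E₁ H₁}
  {E₂ : Type*} [NormedAddCommGroup E₂] [NormedSpace ℝ E₂]
  {H₂ : Type*} [TopologicalSpace H₂] {I₂ : ModelWithCorners ℝ E₂ H₂}
  {M : Type*} [TopologicalSpace M] [ChartedSpace H M]

variable (I) in
lemma contMDiffOn_model_line {n : ℕ∞ω} (a u : E) :
    ContMDiffOn 𝓘(ℝ, ℝ) I n (fun s : ℝ ↦ I.symm (a + s • u)) {s | a + s • u ∈ range I} := by
  refine I.contMDiffOn_symm.comp (ContMDiff.contMDiffOn ?_) fun s hs ↦ hs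
  rw [contMDiff_iff_contDiff]
  fun_prop

namespace Foliation

variable {F : Foliation I I₁ I₂ M}

lemma contMDiffOn_transverse {φ : OpenPartialHomeomorph M (ModelProd H₁ H₂)} (hφ : φ ∈ F.atlas) :
    ContMDiffOn I I₂ ∞ (fun y ↦ ((φ y).2 : H₂)) φ.source :=
  contMDiff_modelProd_snd.comp_contMDiffOn (F.contMDiffOn φ hφ)

lemma mdifferentiableAt_transverse {φ : OpenPartialHomeomorph M (ModelProd H₁ H₂)}
    (hφ : φ ∈ F.atlas) {x : M} (hx : x ∈ φ.source) :
    MDifferentiableAt I I₂ (fun y ↦ ((φ y).2 : H₂)) x :=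
  ((contMDiffOn_transverse hφ).contMDiffAt (φ.open_source.mem_nhds hx)).mdifferentiableAt
    (by simp)

lemma mfderiv_transverse_of_mem_tangent {φ : OpenPartialHomeomorph M (ModelProd H₁ H₂)}
    (hφ : φ ∈ F.atlas) {x : M} (hx : x ∈ φ.source) {v : TangentSpace I x} (hv : v ∈ F.tangent x) :
    mfderiv I I₂ (fun y ↦ ((φ y).2 : H₂)) x v = 0 := by
  simp only [tangent, Submodule.mem_iInf] at hv
  exact hv φ hφ hx

/-- A curve which stays in a plaque is tangent to the foliation. -/
lemma velocity_mem_tangent {φ : OpenPartialHomeomorph M (ModelProd H₁ H₂)} (hφ : φ ∈ F.atlas)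
    {γ : ℝ → M} {t : ℝ} (ht : γ t ∈ φ.source) (hγ : MDifferentiableAt 𝓘(ℝ, ℝ) I γ t)
    (hc : ∀ᶠ s in 𝓝 t, (φ (γ s)).2 = (φ (γ t)).2) : velocity I γ t ∈ F.tangent (γ t) := by
  simp only [tangent, Submodule.mem_iInf]
  intro ψ hψ hx
  obtain ⟨W, hW, -, h⟩ := F.compatible φ hφ ψ hψ (γ t) ⟨ht, hx⟩
  have h1 := mfderiv_comp t (mdifferentiableAt_transverse hψ hx) hγ
  have h2 : ((fun y ↦ ((ψ y).2 : H₂)) ∘ γ) =ᶠ[𝓝 t] fun _ ↦ (ψ (γ t)).2 := by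
    filter_upwards [hc, hγ.continuousAt.preimage_mem_nhds hW] with s hs hsW
    exact h _ hsW _ (mem_of_mem_nhds hW) hs
  rw [h2.mfderiv_eq, mfderiv_const] at h1
  exact (congrArg (fun L ↦ L (1 : ℝ)) h1).symm

variable [IsManifold I ∞ M] [FiniteDimensional ℝ E]
  {g : ContMDiffRiemannianMetric I ∞ E (fun x : M ↦ TangentSpace I x)}

lemma tnorm_warpedMetric_of_mem (f : F.WarpingFunction) {x : M} {v : TangentSpace I x}
    (hv : v ∈ F.tangent x) :
    tnorm (F.warpedMetric g f) x v = f x * tnorm g.toRiemannianMetric x v := by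
  have h : (F.warpedMetric g f).inner x v v = (f x) ^ 2 * g.inner x v v :=
    warpedInner_of_mem f hv hv
  rw [tnorm, h, Real.sqrt_mul (sq_nonneg _), Real.sqrt_sq (f.pos x).le]
  rfl

variable (F g) in
/-- Two points are leafwise close if their distance in `M_f` is controlled by the value of `f`,
uniformly in the warping function `f`. -/
def LeafwiseClose (x y : M) : Prop :=
  F.leafSetoid x y ∧ ∃ K : ℝ≥0∞, K ≠ ⊤ ∧ ∀ f : F.WarpingFunction,
    warpedEDist g f x y ≤ K * ENNReal.ofReal (f x)

lemma LeafwiseClose.symm {x y : M} (h : F.LeafwiseClose g x y) : F.LeafwiseClose g y x := by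
  obtain ⟨h, K, hK, hf⟩ := h
  refine ⟨F.leafSetoid.symm h, K, hK, fun f ↦ ?_⟩
  rw [← f.basic x y h]
  exact (metricEDist_comm _ _ _).trans_le (hf f)

lemma LeafwiseClose.trans {x y z : M} (h : F.LeafwiseClose g x y) (h' : F.LeafwiseClose g y z) :
    F.LeafwiseClose g x z := by
  obtain ⟨h, K, hK, hf⟩ := h
  obtain ⟨h', K', hK', hf'⟩ := h'
  refine ⟨F.leafSetoid.trans h h', K + K', ENNReal.add_ne_top.2 ⟨hK, hK'⟩, fun f ↦ ?_⟩
  rw [add_mul]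
  refine (metricEDist_triangle _ x y z).trans (add_le_add (hf f) ?_)
  rw [f.basic x y h]
  exact hf' f

lemma leafwiseClose_of_curve {φ : OpenPartialHomeomorph M (ModelProd H₁ H₂)} (hφ : φ ∈ F.atlas)
    {γ : ℝ → M} {c : H₂} (hγ : ContMDiffOn 𝓘(ℝ, ℝ) I 1 γ (Icc 0 1))
    (hs : ∀ t ∈ Icc (0 : ℝ) 1, γ t ∈ φ.source ∧ (φ (γ t)).2 = c) :
    F.LeafwiseClose g (γ 0) (γ 1) := by
  have hleaf : ∀ t ∈ Icc (0 : ℝ) 1, F.leafSetoid (γ 0) (γ t) := fun t ht ↦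
    .rel _ _ ⟨φ, hφ, (hs 0 (by simp)).1, (hs t ht).1, (hs 0 (by simp)).2.trans (hs t ht).2.symm⟩
  refine ⟨hleaf 1 (by simp), ?_⟩
  obtain ⟨C, hC0, hC⟩ := exists_tnorm_velocity_le g one_pos hγ
  refine ⟨ENNReal.ofReal C, ENNReal.ofReal_ne_top, fun f ↦ ?_⟩
  have h := metricEDist_le_of_tnorm_le (F.warpedMetric g f) (C := C * f (γ 0)) hγ zero_le_one ?_
  · rwa [sub_zero, ENNReal.ofReal_one, mul_one, ENNReal.ofReal_mul hC0] at h
  · intro t ht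
    have hnhds : Icc (0 : ℝ) 1 ∈ 𝓝 t := Icc_mem_nhds ht.1 ht.2
    have ht' := Ioo_subset_Icc_self ht
    have hmem : velocity I γ t ∈ F.tangent (γ t) := by
      refine velocity_mem_tangent hφ (hs t ht').1
        ((hγ.contMDiffAt hnhds).mdifferentiableAt one_ne_zero) ?_
      filter_upwards [hnhds] with s hs'
      rw [(hs s hs').2, (hs t ht').2]
    rw [tnorm_warpedMetric_of_mem f hmem, ← f.basic _ _ (hleaf t ht'), mul_comm C]
    exact mul_le_mul_of_nonneg_left (hC t ht) (f.pos _).le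

lemma eventually_leafwiseClose {φ : OpenPartialHomeomorph M (ModelProd H₁ H₂)} (hφ : φ ∈ F.atlas)
    {p : H₁} {c : H₂} (hp : ((p, c) : ModelProd H₁ H₂) ∈ φ.target) :
    ∀ᶠ q in 𝓝 p, F.LeafwiseClose g (φ.symm (p, c)) (φ.symm (q, c)) := by
  have hU : {q : H₁ | ((q, c) : ModelProd H₁ H₂) ∈ φ.target} ∈ 𝓝 p := by
    have hcont : Continuous (fun q : H₁ ↦ ((q, c) : ModelProd H₁ H₂)) :=
      Continuous.prodMk continuous_id continuous_const
    exact hcont.continuousAt.preimage_mem_nhds (φ.open_target.mem_nhds hp)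
  have hU' : I₁.symm ⁻¹' {q : H₁ | ((q, c) : ModelProd H₁ H₂) ∈ φ.target} ∈ 𝓝 (I₁ p) :=
    I₁.continuous_symm.continuousAt.preimage_mem_nhds (by rwa [I₁.left_inv])
  obtain ⟨r, hr, hball⟩ := Metric.mem_nhds_iff.1 hU'
  filter_upwards [I₁.continuous.continuousAt.preimage_mem_nhds (Metric.ball_mem_nhds _ hr)]
    with q hq
  have hseg : ∀ s ∈ Icc (0 : ℝ) 1, I₁ p + s • (I₁ q - I₁ p) ∈ Metric.ball (I₁ p) r ∩ range I₁ :=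
    fun s hs ↦ ((convex_ball _ _).inter I₁.convex_range).add_smul_sub_mem
      ⟨Metric.mem_ball_self hr, mem_range_self _⟩ ⟨hq, mem_range_self _⟩ hs
  have htar : ∀ s ∈ Icc (0 : ℝ) 1,
      ((I₁.symm (I₁ p + s • (I₁ q - I₁ p)), c) : ModelProd H₁ H₂) ∈ φ.target :=
    fun s hs ↦ hball (hseg s hs).1
  have hκ : ContMDiffOn (M' := ModelProd H₁ H₂) 𝓘(ℝ, ℝ) (I₁.prod I₂) 1
      (fun s : ℝ ↦ (I₁.symm (I₁ p + s • (I₁ q - I₁ p)), c)) (Icc 0 1) :=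
    contMDiffOn_modelProdMk ((contMDiffOn_model_line I₁ _ _).mono fun s hs ↦ (hseg s hs).2)
      contMDiffOn_const
  have h := leafwiseClose_of_curve (F := F) (g := g) hφ (c := c)
    (γ := fun s ↦ φ.symm (I₁.symm (I₁ p + s • (I₁ q - I₁ p)), c))
    (((F.contMDiffOn_symm φ hφ).of_le (by simp)).comp hκ htar)
    fun t ht ↦ ⟨φ.map_target (htar t ht), by rw [φ.right_inv (htar t ht)]⟩
  simpa using h

/-- Points of a plaque are leafwise close. -/
lemma leafwiseClose_of_samePlaque {x y : M} (h : F.SamePlaque x y) : F.LeafwiseClose g x y := by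
  obtain ⟨φ, hφ, hx, hy, hxy⟩ := h
  obtain ⟨U₁, U₂, hU₁, htar⟩ := F.target_eq_prod φ hφ
  have hx' := φ.map_source hx
  have hy' := φ.map_source hy
  rw [htar] at hx' hy'
  have hmem : ∀ p ∈ U₁, ((p, (φ x).2) : ModelProd H₁ H₂) ∈ φ.target := fun p hp ↦ by
    rw [htar]; exact ⟨hp, hx'.2⟩
  have h := hU₁.induction₂
    (fun p q ↦ F.LeafwiseClose g (φ.symm (p, (φ x).2)) (φ.symm (q, (φ x).2)))
    (fun p hp ↦ nhdsWithin_le_nhds (eventually_leafwiseClose hφ (hmem p hp)))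
    (fun _ _ _ _ _ _ h h' ↦ h.trans h') (fun _ _ _ _ h ↦ h.symm) hx'.1 hy'.1
  have h1 : φ.symm ((φ x).1, (φ x).2) = x := φ.left_inv hx
  have h2 : φ.symm ((φ y).1, (φ x).2) = y := by rw [hxy]; exact φ.left_inv hy
  rwa [h1, h2] at h

end Foliation
end Leaves

section Transverse

variable {E : Type*} [NormedAddCommGroup E] [NormedSpace ℝ E]
  {H : Type*} [TopologicalSpace H] {I : ModelWithCorners ℝ E H}
  {E₁ : Type*} [NormedAddCommGroup E₁] [NormedSpace ℝ E₁]
  {H₁ : Type*} [TopologicalSpace H₁] {I₁ : ModelWithCorners ℝ E₁ H₁}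
  {E₂ : Type*} [NormedAddCommGroup E₂] [NormedSpace ℝ E₂]
  {H₂ : Type*} [TopologicalSpace H₂] {I₂ : ModelWithCorners ℝ E₂ H₂}
  {M : Type*} [TopologicalSpace M] [ChartedSpace H M]

namespace Foliation

variable {F : Foliation I I₁ I₂ M}

lemma mdifferentiableAt_chart {φ : OpenPartialHomeomorph M (ModelProd H₁ H₂)} (hφ : φ ∈ F.atlas)
    {x : M} (hx : x ∈ φ.source) : MDifferentiableAt I (I₁.prod I₂) φ x :=
  ((F.contMDiffOn φ hφ).contMDiffAt (φ.open_source.mem_nhds hx)).mdifferentiableAt (by simp)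

lemma mdifferentiableAt_chart_symm {φ : OpenPartialHomeomorph M (ModelProd H₁ H₂)}
    (hφ : φ ∈ F.atlas) {z : ModelProd H₁ H₂} (hz : z ∈ φ.target) :
    MDifferentiableAt (I₁.prod I₂) I φ.symm z :=
  ((F.contMDiffOn_symm φ hφ).contMDiffAt (φ.open_target.mem_nhds hz)).mdifferentiableAt (by simp)

lemma tangentMap_chart_symm_tangentMap_chart {φ : OpenPartialHomeomorph M (ModelProd H₁ H₂)}
    (hφ : φ ∈ F.atlas) {p : TangentBundle I M} (hp : p.proj ∈ φ.source) :
    tangentMap (I₁.prod I₂) I φ.symm (tangentMap I (I₁.prod I₂) φ p) = p := by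
  have h1 : MDifferentiableAt (I₁.prod I₂) I φ.symm (φ p.proj) :=
    mdifferentiableAt_chart_symm hφ (φ.map_source hp)
  rw [← tangentMap_comp_at p h1 (mdifferentiableAt_chart hφ hp)]
  have h : (φ.symm ∘ φ) =ᶠ[𝓝 p.proj] id := by
    filter_upwards [φ.open_source.mem_nhds hp] with y hy using φ.left_inv hy
  refine TotalSpace.ext (φ.left_inv hp) ?_
  rw [tangentMap_snd, h.mfderiv_eq, mfderiv_id]
  rfl

lemma snd_mfderiv_chart {φ : OpenPartialHomeomorph M (ModelProd H₁ H₂)} (hφ : φ ∈ F.atlas)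
    {x : M} (hx : x ∈ φ.source) (v : TangentSpace I x) :
    (show E₁ × E₂ from mfderiv I (I₁.prod I₂) φ x v).2 =
      mfderiv I I₂ (fun y ↦ ((φ y).2 : H₂)) x v := by
  have h := mfderiv_comp x (I'' := I₂) (g := fun z : ModelProd H₁ H₂ ↦ z.2)
    ((contMDiff_modelProd_snd (I₁ := I₁) (I₂ := I₂) (n := 1)).mdifferentiable (by simp) _)
    (mdifferentiableAt_chart hφ hx)
  rw [mfderiv_modelProd_snd] at h
  exact (congrArg (fun L ↦ L v) h).symm

variable [IsManifold I ∞ M]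
  {g : ContMDiffRiemannianMetric I ∞ E (fun x : M ↦ TangentSpace I x)}

/-- Near a point `x` of a foliated chart there are points of the same plaque, in the interior in
the direction of the leaves, to which a given tangent vector extends with almost the same norm. -/
lemma exists_interior_tnorm_lt {φ : OpenPartialHomeomorph M (ModelProd H₁ H₂)} (hφ : φ ∈ F.atlas)
    {x : M} (hx : x ∈ φ.source) (w : TangentSpace I x) {C : ℝ}
    (hC : tnorm g.toRiemannianMetric x w < C) :
    ∃ e ∈ interior (range I₁), ((I₁.symm e, (φ x).2) : ModelProd H₁ H₂) ∈ φ.target ∧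
      ∀ p : TangentBundle (I₁.prod I₂) (ModelProd H₁ H₂),
        p = ⟨(I₁.symm e, (φ x).2), mfderiv I (I₁.prod I₂) φ x w⟩ →
        tnorm g.toRiemannianMetric (tangentMap (I₁.prod I₂) I φ.symm p).proj
          (tangentMap (I₁.prod I₂) I φ.symm p).2 < C := by
  let J := I₁.prod I₂
  let V : E₁ × E₂ := mfderiv I J φ x w
  let P : E₁ → TangentBundle J (ModelProd H₁ H₂) := fun e ↦ ⟨(I₁.symm e, (φ x).2), V⟩
  have hP : Continuous P :=
    (tangentBundleModelSpaceHomeomorph J).symm.continuous.comp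
      ((I₁.continuous_symm.prodMk continuous_const).prodMk continuous_const :
        Continuous (fun e : E₁ ↦ (((I₁.symm e, (φ x).2) : H₁ × H₂), V)))
  have hP0 : P (I₁ (φ x).1) = tangentMap I J φ ⟨x, w⟩ :=
    TotalSpace.ext (Prod.ext (I₁.left_inv _) rfl) (heq_of_eq rfl)
  have htar : (P (I₁ (φ x).1)).proj ∈ φ.target := by
    rw [hP0]; exact φ.map_source hx
  have hcont : ContinuousOn (tangentMap J I φ.symm) (TotalSpace.proj ⁻¹' φ.target) :=
    ((F.contMDiffOn_symm φ hφ).continuousOn_tangentMapWithin (by simp)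
      φ.open_target.uniqueMDiffOn).congr fun p hp ↦
      (tangentMapWithin_eq_tangentMap (φ.open_target.uniqueMDiffOn _ hp)
        (mdifferentiableAt_chart_symm hφ hp)).symm
  have hopen : IsOpen (TotalSpace.proj ⁻¹' φ.target : Set (TangentBundle J (ModelProd H₁ H₂))) :=
    φ.open_target.preimage (FiberBundle.continuous_proj (E₁ × E₂) (TangentSpace J))
  have hat : ContinuousAt (fun e ↦ tnorm g.toRiemannianMetric
      (tangentMap J I φ.symm (P e)).proj (tangentMap J I φ.symm (P e)).2) (I₁ (φ x).1) :=
    (continuous_tnorm g).continuousAt.comp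
      ((hcont.continuousAt (hopen.mem_nhds htar)).comp hP.continuousAt)
  have hlt : tnorm g.toRiemannianMetric (tangentMap J I φ.symm (P (I₁ (φ x).1))).proj
      (tangentMap J I φ.symm (P (I₁ (φ x).1))).2 < C := by
    have h : tangentMap J I φ.symm (P (I₁ (φ x).1)) = ⟨x, w⟩ := by
      rw [hP0]
      exact tangentMap_chart_symm_tangentMap_chart hφ (p := ⟨x, w⟩) hx
    rw [h]
    exact hC
  have hev := (hat.eventually (gt_mem_nhds hlt)).and
    (hP.continuousAt.preimage_mem_nhds (hopen.mem_nhds htar))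
  obtain ⟨e, ⟨he, he'⟩, hint⟩ := mem_closure_iff_nhds.1
    (I₁.range_subset_closure_interior (mem_range_self (φ x).1)) _ hev
  refine ⟨e, hint, he', ?_⟩
  rintro p rfl
  exact he

/-- The infinitesimal distance between the leaves along a curve is at most the norm of the
component of the velocity which is transverse to the leaves. -/
lemma eventually_leafDist_le {γ : ℝ → M} (hγ : ContMDiff 𝓘(ℝ, ℝ) I 1 γ) (t : ℝ)
    (w : TangentSpace I (γ t)) (hw : velocity I γ t - w ∈ F.tangent (γ t)) {C : ℝ}
    (hC : tnorm g.toRiemannianMetric (γ t) w < C) :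
    ∀ᶠ s in 𝓝 t, leafDist (leafOf (γ t) : F.LeafSpace g) (leafOf (γ s)) ≤
      ENNReal.ofReal C * ENNReal.ofReal |s - t| := by
  obtain ⟨φ, hφ, hx⟩ := F.exists_mem_source (γ t)
  obtain ⟨e, he, htar, hN⟩ := exists_interior_tnorm_lt (g := g) hφ hx w hC
  let J := I₁.prod I₂
  let V : E₁ × E₂ := mfderiv I J φ (γ t) w
  let b : ℝ → H₂ := fun s ↦ (φ (γ s)).2
  let κ : ℝ → ModelProd H₁ H₂ := fun s ↦ (I₁.symm ((e - t • V.1) + s • V.1), b s)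
  have het : (e - t • V.1) + t • V.1 = e := sub_add_cancel _ _
  let A : Set ℝ := {s | (e - t • V.1) + s • V.1 ∈ interior (range I₁)} ∩ γ ⁻¹' φ.source
  have hA : A ∈ 𝓝 t := by
    refine inter_mem ?_ (hγ.continuous.continuousAt.preimage_mem_nhds (φ.open_source.mem_nhds hx))
    have hl : Continuous (fun s : ℝ ↦ (e - t • V.1) + s • V.1) := by fun_prop
    exact hl.continuousAt.preimage_mem_nhds (isOpen_interior.mem_nhds (by rwa [het]))
  have hb : ContMDiffOn 𝓘(ℝ, ℝ) I₂ 1 b A :=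
    ((contMDiffOn_transverse hφ).of_le (by simp)).comp hγ.contMDiffOn fun s hs ↦ hs.2
  have hκ : ContMDiffOn 𝓘(ℝ, ℝ) J 1 κ A :=
    contMDiffOn_modelProdMk
      ((contMDiffOn_model_line I₁ _ _).mono fun s hs ↦
        interior_subset (s := range I₁) hs.1) hb
  have hκt : κ t = (I₁.symm e, (φ (γ t)).2) := by simp only [κ, het, b]
  have hB : A ∩ κ ⁻¹' φ.target ∈ 𝓝 t := inter_mem hA
    ((hκ.continuousOn.continuousAt hA).preimage_mem_nhds
      (φ.open_target.mem_nhds (by rw [hκt]; exact htar)))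
  have hη : ContMDiffOn 𝓘(ℝ, ℝ) I 1 (φ.symm ∘ κ) (A ∩ κ ⁻¹' φ.target) :=
    ((F.contMDiffOn_symm φ hφ).of_le (by simp)).comp (hκ.mono inter_subset_left)
      fun s hs ↦ hs.2
  have hκd : MDifferentiableAt 𝓘(ℝ, ℝ) J κ t :=
    (hκ.contMDiffAt hA).mdifferentiableAt one_ne_zero
  have hbd : MDifferentiableAt 𝓘(ℝ, ℝ) I₂ b t :=
    (hb.contMDiffAt hA).mdifferentiableAt one_ne_zero
  have hb' : (fderiv ℝ (I₂ ∘ b) t 1 : E₂) = V.2 := by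
    have h1 : mfderiv 𝓘(ℝ, ℝ) I₂ b t = (mfderiv I I₂ (fun y ↦ ((φ y).2 : H₂)) (γ t)).comp
        (mfderiv 𝓘(ℝ, ℝ) I γ t) :=
      mfderiv_comp t (mdifferentiableAt_transverse hφ hx) (hγ.mdifferentiable one_ne_zero t)
    have h2 : mfderiv I I₂ (fun y ↦ ((φ y).2 : H₂)) (γ t) (velocity I γ t) =
        mfderiv I I₂ (fun y ↦ ((φ y).2 : H₂)) (γ t) w := by
      rw [← sub_eq_zero, ← map_sub]
      exact mfderiv_transverse_of_mem_tangent hφ hx hw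
    rw [← mfderiv_eq_fderiv_model hbd, h1]
    exact h2.trans (snd_mfderiv_chart hφ hx w).symm
  have hκ' : mfderiv 𝓘(ℝ, ℝ) J κ t (1 : ℝ) = V := by
    have h1 : J ∘ κ =ᶠ[𝓝 t] fun s ↦ ((e - t • V.1) + s • V.1, (I₂ ∘ b) s) := by
      filter_upwards [hA] with s hs
      refine Prod.ext ?_ rfl
      exact I₁.right_inv (interior_subset hs.1)
    have h2 : DifferentiableAt ℝ (I₂ ∘ b) t := by
      have := (I₂.contMDiff (n := 1)).mdifferentiable one_ne_zero (b t)
      exact (this.comp t hbd).differentiableAt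
    have h3 : HasDerivAt (fun s : ℝ ↦ (e - t • V.1) + s • V.1) V.1 t := by
      simpa using ((hasDerivAt_id t).smul_const V.1).const_add (e - t • V.1)
    have h4 := h3.prodMk h2.hasDerivAt
    have h5 : fderiv ℝ (J ∘ κ) t (1 : ℝ) = V := by
      rw [h1.fderiv_eq, fderiv_apply_one_eq_deriv, h4.deriv]
      refine Prod.ext rfl ?_
      rw [← hb', fderiv_apply_one_eq_deriv]
    exact (congrArg (fun L : ℝ →L[ℝ] E₁ × E₂ ↦ L 1) (mfderiv_eq_fderiv_model hκd)).trans h5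
  have hlt : tnorm g.toRiemannianMetric ((φ.symm ∘ κ) t) (velocity I (φ.symm ∘ κ) t) < C := by
    have hst : MDifferentiableAt J I φ.symm (κ t) :=
      mdifferentiableAt_chart_symm hφ (mem_of_mem_nhds hB).2
    have h1 := tangentMap_comp_at (⟨t, (1 : ℝ)⟩ : TangentBundle 𝓘(ℝ, ℝ) ℝ) hst hκd
    have h2 := hN (tangentMap 𝓘(ℝ, ℝ) J κ ⟨t, (1 : ℝ)⟩)
      (TotalSpace.ext hκt (heq_of_eq hκ'))
    rw [← h1] at h2
    exact h2
  obtain ⟨δ, hδ, hball⟩ := Metric.mem_nhds_iff.1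
    (inter_mem hB ((continuousAt_tnorm_velocity g hB hη).eventually (gt_mem_nhds hlt)))
  have hleaf : ∀ s ∈ Metric.ball t δ,
      (leafOf (γ s) : F.LeafSpace g) = leafOf ((φ.symm ∘ κ) s) := by
    intro s hs
    have hs' := (hball hs).1
    refine Quotient.sound (.rel _ _ ⟨φ, hφ, hs'.1.2, φ.map_target hs'.2, ?_⟩)
    rw [Function.comp_apply, φ.right_inv hs'.2]
  have key : ∀ r s, r ∈ Metric.ball t δ → s ∈ Metric.ball t δ → r ≤ s →
      leafDist (leafOf (γ r) : F.LeafSpace g) (leafOf (γ s)) ≤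
        ENNReal.ofReal C * ENNReal.ofReal |s - r| := by
    intro r s hr hs hrs
    have hsub : Icc r s ⊆ Metric.ball t δ := (convex_ball t δ).ordConnected.out hr hs
    rw [hleaf r hr, hleaf s hs, abs_of_nonneg (sub_nonneg.2 hrs)]
    refine (leafDist_le _ _).trans (metricEDist_le_of_tnorm_le _
      (hη.mono fun u hu ↦ (hball (hsub hu)).1) hrs fun u hu ↦ ?_)
    exact (hball (hsub (Ioo_subset_Icc_self hu))).2.le
  filter_upwards [Metric.ball_mem_nhds t hδ] with s hs
  rcases le_total t s with h | h
  · exact key t s (Metric.mem_ball_self hδ) hs h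
  · rw [leafDist_comm, abs_sub_comm]
    exact key s t hs (Metric.mem_ball_self hδ) h

end Foliation
end Transverse

section LowerBound

variable {E : Type*} [NormedAddCommGroup E] [NormedSpace ℝ E]
  {H : Type*} [TopologicalSpace H] {I : ModelWithCorners ℝ E H}
  {E₁ : Type*} [NormedAddCommGroup E₁] [NormedSpace ℝ E₁]
  {H₁ : Type*} [TopologicalSpace H₁] {I₁ : ModelWithCorners ℝ E₁ H₁}
  {E₂ : Type*} [NormedAddCommGroup E₂] [NormedSpace ℝ E₂]
  {H₂ : Type*} [TopologicalSpace H₂] {I₂ : ModelWithCorners ℝ E₂ H₂}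
  {M : Type*} [TopologicalSpace M] [ChartedSpace H M]

/-- A Lipschitz function grows at most by the lower integral of a pointwise bound of its
difference quotients. -/
lemma ofReal_sub_le_lintegral {r : ℝ → ℝ} {a b : ℝ} (hab : a ≤ b) {K : NNReal}
    (hr : LipschitzOnWith K r (Icc a b)) (u : ℝ → ℝ)
    (h : ∀ t ∈ Ioo a b, ∀ C, u t < C → 0 ≤ C → ∀ᶠ s in 𝓝 t, |r s - r t| ≤ C * |s - t|) :
    ENNReal.ofReal (r b - r a) ≤ ∫⁻ t in Ioo a b, ENNReal.ofReal (u t) := by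
  rw [← uIcc_of_le hab] at hr
  have hac := hr.absolutelyContinuousOnInterval
  have hint := hac.intervalIntegrable_deriv
  rw [intervalIntegrable_iff_integrableOn_Ioo_of_le hab] at hint
  rw [← hac.integral_deriv_eq_sub, intervalIntegral.integral_of_le hab,
    MeasureTheory.integral_Ioc_eq_integral_Ioo]
  refine (ENNReal.ofReal_le_ofReal ((Real.le_norm_self _).trans
    (MeasureTheory.norm_integral_le_integral_norm _))).trans ?_
  rw [MeasureTheory.ofReal_integral_norm_eq_lintegral_enorm hint]
  refine MeasureTheory.setLIntegral_mono' measurableSet_Ioo fun t ht ↦ ?_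
  rw [← ofReal_norm]
  have hle : ‖deriv r t‖ ≤ max (u t) 0 := by
    refine le_of_forall_gt_imp_ge_of_dense fun C hC ↦ ?_
    rw [norm_deriv_eq_norm_fderiv]
    exact norm_fderiv_le_of_lip' ℝ ((le_max_right _ _).trans hC.le)
      (h t ht C ((le_max_left _ _).trans_lt hC) ((le_max_right _ _).trans hC.le))
  refine (ENNReal.ofReal_le_ofReal hle).trans_eq ?_
  rcases le_total (u t) 0 with h0 | h0
  · rw [max_eq_right h0, ENNReal.ofReal_zero, ENNReal.ofReal_of_nonpos h0]
  · rw [max_eq_left h0]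

namespace Foliation

variable {F : Foliation I I₁ I₂ M} [IsManifold I ∞ M]
  {g : ContMDiffRiemannianMetric I ∞ E (fun x : M ↦ TangentSpace I x)}

lemma dist_leafOf_le [ConnectedSpace M] {x y : M} {C : ℝ} (hC : 0 ≤ C)
    (h : leafDist (leafOf x : F.LeafSpace g) (leafOf y) ≤ ENNReal.ofReal C) :
    dist (leafOf x : F.LeafSpace g) (leafOf y) ≤ C := by
  rw [← ENNReal.ofReal_le_ofReal_iff hC, ← edist_dist, LeafSpace.edist_eq]
  exact (rho_le_leafDist _ _).trans h

variable [FiniteDimensional ℝ E]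

lemma tnorm_sub_tangentProj_le (f : F.WarpingFunction) (x : M) (v : TangentSpace I x) :
    tnorm g.toRiemannianMetric x (v - F.tangentProj g x v) ≤ tnorm (F.warpedMetric g f) x v := by
  refine Real.sqrt_le_sqrt ?_
  have h : (F.warpedMetric g f).inner x v v = F.warpedInner g f x v v := rfl
  rw [h, warpedInner_apply]
  have := mul_nonneg (sq_nonneg (f x)) (inner_self_nonneg (g := g) x (F.tangentProj g x v))
  exact le_add_of_nonneg_left this

/-- The projection of a warped foliation to the leaf space is distance nonincreasing. -/
lemma rho_le_warpedEDist [ConnectedSpace M] (f : F.WarpingFunction) (x y : M) :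
    rho (leafOf x : F.LeafSpace g) (leafOf y) ≤ warpedEDist g f x y := by
  refine le_of_forall_gt_imp_ge_of_dense fun R hR ↦ ?_
  obtain ⟨γ, rfl, rfl, hγ, hlt⟩ := exists_curve_of_metricEDist_lt _ hR
  refine le_trans ?_ hlt.le
  obtain ⟨K, hK, hbound⟩ := exists_tnorm_velocity_le g one_pos hγ.contMDiffOn
  let r : ℝ → ℝ := fun s ↦ dist (leafOf (γ 0) : F.LeafSpace g) (leafOf (γ s))
  have hrsub : ∀ s t, |r s - r t| ≤ dist (leafOf (γ t) : F.LeafSpace g) (leafOf (γ s)) := by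
    intro s t
    rw [dist_comm (leafOf (γ t) : F.LeafSpace g)]
    simp only [r, dist_comm (leafOf (γ 0) : F.LeafSpace g)]
    exact abs_dist_sub_le _ _ _
  have hr : LipschitzOnWith K.toNNReal r (Icc 0 1) := by
    have key : ∀ s ∈ Icc (0 : ℝ) 1, ∀ t ∈ Icc (0 : ℝ) 1, s ≤ t → |r s - r t| ≤ K * (t - s) := by
      intro s hs t ht hst
      have h0 : 0 ≤ K * (t - s) := mul_nonneg hK (sub_nonneg.2 hst)
      refine (hrsub s t).trans ?_
      rw [dist_comm]
      refine dist_leafOf_le h0 ((leafDist_le _ _).trans ?_)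
      rw [ENNReal.ofReal_mul hK]
      exact metricEDist_le_of_tnorm_le _ hγ.contMDiffOn hst fun u hu ↦
        hbound u ⟨hs.1.trans_lt hu.1, hu.2.trans_le ht.2⟩
    refine LipschitzOnWith.of_dist_le_mul fun s hs t ht ↦ ?_
    rw [Real.coe_toNNReal _ hK, Real.dist_eq, Real.dist_eq]
    rcases le_total s t with h | h
    · rw [abs_sub_comm s t, abs_of_nonneg (sub_nonneg.2 h)]
      exact key s hs t ht h
    · rw [abs_sub_comm, abs_of_nonneg (sub_nonneg.2 h)]
      exact key t ht s hs h
  have h := ofReal_sub_le_lintegral zero_le_one hr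
    (fun t ↦ tnorm (F.warpedMetric g f) (γ t) (velocity I γ t)) fun t _ C hC hC0 ↦ by
      have hw : velocity I γ t - (velocity I γ t - F.tangentProj g (γ t) (velocity I γ t)) ∈
          F.tangent (γ t) := by
        rw [sub_sub_cancel]
        exact tangentProj_mem _ _
      filter_upwards [eventually_leafDist_le (g := g) hγ t _ hw
        ((tnorm_sub_tangentProj_le f _ _).trans_lt hC)] with s hs
      refine (hrsub s t).trans (dist_leafOf_le (by positivity) ?_)
      rwa [ENNReal.ofReal_mul hC0]
  rw [← LeafSpace.edist_eq, edist_dist]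
  simpa only [r, dist_self, sub_zero] using h

end Foliation
end LowerBound

section UpperBound

variable {E : Type*} [NormedAddCommGroup E] [NormedSpace ℝ E] [FiniteDimensional ℝ E]
  {H : Type*} [TopologicalSpace H] {I : ModelWithCorners ℝ E H}
  {E₁ : Type*} [NormedAddCommGroup E₁] [NormedSpace ℝ E₁]
  {H₁ : Type*} [TopologicalSpace H₁] {I₁ : ModelWithCorners ℝ E₁ H₁}
  {E₂ : Type*} [NormedAddCommGroup E₂] [NormedSpace ℝ E₂]
  {H₂ : Type*} [TopologicalSpace H₂] {I₂ : ModelWithCorners ℝ E₂ H₂}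
  {M : Type*} [TopologicalSpace M] [ChartedSpace H M] [IsManifold I ∞ M]

namespace Foliation

variable {F : Foliation I I₁ I₂ M}
  {g : ContMDiffRiemannianMetric I ∞ E (fun x : M ↦ TangentSpace I x)}

lemma warpedEDist_triangle (f : F.WarpingFunction) (x y z : M) :
    warpedEDist g f x z ≤ warpedEDist g f x y + warpedEDist g f y z :=
  metricEDist_triangle _ x y z

lemma warpedEDist_comm (f : F.WarpingFunction) (x y : M) :
    warpedEDist g f x y = warpedEDist g f y x :=
  metricEDist_comm _ x y

lemma warpedEDist_le_gEDist {f : F.WarpingFunction} (hf : ∀ x, f x < 1) (x y : M) :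
    warpedEDist g f x y ≤ gEDist g x y := by
  have h := metricEDist_le_mul (F.warpedMetric g f) g.toRiemannianMetric one_pos
    (fun z v ↦ warpedInner_le f z v le_rfl (hf z).le) x y
  rwa [ENNReal.ofReal_one, one_mul] at h

variable {G : Set M} (hG : Dense G) {f : ℕ → F.WarpingFunction} (hf : ∀ n x, f n x < 1)
  (hfG : ∀ x ∈ G, Tendsto (fun n ↦ f n x) atTop (𝓝 0))

lemma LeafwiseClose.tendsto_warpedEDist {x y : M} (h : F.LeafwiseClose g x y)
    (hx : Tendsto (fun n ↦ f n x) atTop (𝓝 0)) :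
    Tendsto (fun n ↦ warpedEDist g (f n) x y) atTop (𝓝 0) := by
  obtain ⟨-, K, hK, hle⟩ := h
  refine tendsto_of_tendsto_of_tendsto_of_le_of_le tendsto_const_nhds ?_
    (fun n ↦ bot_le) (fun n ↦ hle (f n))
  have h := ENNReal.Tendsto.const_mul (ENNReal.tendsto_ofReal hx) (.inr hK)
  simpa using h

include hG hf hfG

lemma eventually_warpedEDist_lt_of_samePlaque {x y : M} (h : F.SamePlaque x y) {ε : ℝ≥0∞}
    (hε : 0 < ε) : ∀ᶠ n in atTop, warpedEDist g (f n) x y < ε := by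
  obtain ⟨φ, hφ, hx, hy, hxy⟩ := h
  obtain ⟨U₁, U₂, -, htar⟩ := F.target_eq_prod φ hφ
  have hε3 : 0 < ε / 3 := ENNReal.div_pos hε.ne' (by simp)
  let κ : M → ModelProd H₁ H₂ := fun z ↦ ((φ y).1, (φ z).2)
  have hκx : κ x = φ y := Prod.ext rfl hxy
  have hκ : ContinuousAt κ x :=
    continuousAt_const.prodMk (continuous_snd.continuousAt.comp (φ.continuousAt hx))
  have hcont : ContinuousAt (fun z ↦ φ.symm (κ z)) x :=
    ContinuousAt.comp (g := φ.symm) (φ.continuousAt_symm (by rw [hκx]; exact φ.map_source hy)) hκ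
  have hev : ∀ᶠ z in 𝓝 x, gEDist g y (φ.symm (κ z)) < ε / 3 := by
    refine hcont.eventually (p := fun w ↦ gEDist g y w < ε / 3) ?_
    change ∀ᶠ w in 𝓝 (φ.symm (κ x)), gEDist g y w < ε / 3
    rw [hκx, φ.left_inv hy]
    exact eventually_gEDist_lt g y hε3
  obtain ⟨z, ⟨⟨hz1, hz2⟩, hz⟩, hzG⟩ := mem_closure_iff_nhds.1 (hG x) _
    (((eventually_gEDist_lt g x hε3).and hev).and (φ.open_source.mem_nhds hx))
  have hκz : κ z ∈ φ.target := by
    have h1 := φ.map_source hy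
    have h2 := φ.map_source hz
    rw [htar] at h1 h2 ⊢
    exact ⟨h1.1, h2.2⟩
  have hplaque : F.SamePlaque z (φ.symm (κ z)) :=
    ⟨φ, hφ, hz, φ.map_target hκz, by rw [φ.right_inv hκz]⟩
  have hlim := (leafwiseClose_of_samePlaque (g := g) hplaque).tendsto_warpedEDist (hfG z hzG)
  filter_upwards [hlim.eventually (gt_mem_nhds hε3)] with n hn
  calc warpedEDist g (f n) x y
      ≤ warpedEDist g (f n) x z + warpedEDist g (f n) z (φ.symm (κ z)) +
          warpedEDist g (f n) (φ.symm (κ z)) y :=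
        (warpedEDist_triangle _ _ _ _).trans (add_le_add_left (warpedEDist_triangle _ _ _ _) _)
    _ < ε / 3 + ε / 3 + ε / 3 := by
        refine ENNReal.add_lt_add (ENNReal.add_lt_add ?_ hn) ?_
        · exact (warpedEDist_le_gEDist (hf n) _ _).trans_lt hz1
        · rw [warpedEDist_comm]
          exact (warpedEDist_le_gEDist (hf n) _ _).trans_lt hz2
    _ = ε := ENNReal.add_thirds ε

lemma eventually_warpedEDist_lt_of_leafSetoid {x y : M} (h : F.leafSetoid x y) {ε : ℝ≥0∞}
    (hε : 0 < ε) : ∀ᶠ n in atTop, warpedEDist g (f n) x y < ε := by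
  induction h generalizing ε with
  | rel x y h => exact eventually_warpedEDist_lt_of_samePlaque hG hf hfG h hε
  | refl x =>
    refine .of_forall fun n ↦ ?_
    rw [warpedEDist, metricEDist_self]
    exact hε
  | symm x y _ ih =>
    filter_upwards [ih hε] with n hn
    rwa [warpedEDist_comm]
  | trans x y z _ _ ih ih' =>
    have hε2 : 0 < ε / 2 := ENNReal.half_pos hε.ne'
    filter_upwards [ih hε2, ih' hε2] with n hn hn'
    refine (warpedEDist_triangle _ _ y _).trans_lt ?_
    rw [← ENNReal.add_halves ε]
    exact ENNReal.add_lt_add hn hn'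

lemma eventually_warpedEDist_lt_of_leafDist_lt {x y : M} {R : ℝ≥0∞}
    (h : leafDist (leafOf x : F.LeafSpace g) (leafOf y) < R) :
    ∀ᶠ n in atTop, warpedEDist g (f n) x y < R := by
  simp only [leafDist, iInf_lt_iff] at h
  obtain ⟨x', y', hx, hy, hlt⟩ := h
  obtain ⟨S, hS, hSR⟩ := exists_between hlt
  have hε : 0 < (R - S) / 2 := ENNReal.half_pos (tsub_pos_of_lt hSR).ne'
  filter_upwards [eventually_warpedEDist_lt_of_leafSetoid (g := g) hG hf hfG
    (F.leafSetoid.symm (Quotient.exact hx)) hε,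
    eventually_warpedEDist_lt_of_leafSetoid (g := g) hG hf hfG (Quotient.exact hy) hε]
    with n hn hn'
  calc warpedEDist g (f n) x y
      ≤ warpedEDist g (f n) x' y' + (warpedEDist g (f n) x x' + warpedEDist g (f n) y' y) := by
        refine (warpedEDist_triangle _ _ x' _).trans
          ((add_le_add_right (warpedEDist_triangle _ x' y' y) _).trans (le_of_eq ?_))
        ring
    _ < S + ((R - S) / 2 + (R - S) / 2) :=
        ENNReal.add_lt_add ((warpedEDist_le_gEDist (hf n) _ _).trans_lt hS)
          (ENNReal.add_lt_add hn hn')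
    _ = R := by rw [ENNReal.add_halves, add_tsub_cancel_of_le hSR.le]

lemma eventually_warpedEDist_lt_of_sum_lt (m : ℕ) (c : ℕ → F.LeafSpace g) {x y : M}
    (hx : leafOf x = c 0) (hy : leafOf y = c m) {R : ℝ≥0∞}
    (h : ∑ i ∈ Finset.range m, leafDist (c i) (c (i + 1)) < R) :
    ∀ᶠ n in atTop, warpedEDist g (f n) x y < R := by
  induction m generalizing y R with
  | zero =>
    refine eventually_warpedEDist_lt_of_leafSetoid hG hf hfG (Quotient.exact ?_)
      (lt_of_le_of_lt bot_le h)
    exact hx.trans hy.symm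
  | succ m ih =>
    rw [Finset.sum_range_succ] at h
    obtain ⟨z, hz⟩ := leafOf_surjective (c m)
    obtain ⟨A, hA, B, hB, hAB⟩ := ENNReal.exists_add_lt_of_add_lt h
    filter_upwards [ih hz hA, eventually_warpedEDist_lt_of_leafDist_lt (x := z) (y := y) (g := g)
      hG hf hfG (by rwa [hz, hy])] with n hn hn'
    exact (warpedEDist_triangle _ _ z _).trans_lt ((ENNReal.add_lt_add hn hn').trans hAB)

lemma eventually_warpedEDist_lt {x y : M} {R : ℝ≥0∞}
    (h : rho (leafOf x : F.LeafSpace g) (leafOf y) < R) :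
    ∀ᶠ n in atTop, warpedEDist g (f n) x y < R := by
  simp only [rho, iInf_lt_iff] at h
  obtain ⟨m, c, h0, hm, hlt⟩ := h
  exact eventually_warpedEDist_lt_of_sum_lt hG hf hfG m c h0.symm hm.symm hlt

/-- The convergence of the warped distances to the distance of the leaf space is uniform. -/
lemma eventually_forall_warpedEDist_le [CompactSpace M] [ConnectedSpace M] {ε : ℝ≥0∞}
    (hε : 0 < ε) : ∀ᶠ n in atTop, ∀ x y,
      warpedEDist g (f n) x y ≤ rho (leafOf x : F.LeafSpace g) (leafOf y) + 5 * ε := by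
  obtain ⟨s, hs⟩ := isCompact_univ.elim_nhds_subcover (fun x : M ↦ {y | gEDist g x y < ε})
    fun x _ ↦ eventually_gEDist_lt g x hε
  have hcov : ∀ x, ∃ p ∈ s, gEDist g p x < ε := fun x ↦ by
    simpa using hs.2 (mem_univ x)
  have hfin : ∀ᶠ n in atTop, ∀ p ∈ s, ∀ q ∈ s,
      warpedEDist g (f n) p q < rho (leafOf p : F.LeafSpace g) (leafOf q) + ε := by
    rw [Finset.eventually_all]
    intro p _
    rw [Finset.eventually_all]
    intro q _
    refine eventually_warpedEDist_lt hG hf hfG (ENNReal.lt_add_right ?_ hε.ne')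
    exact (((rho_le_leafDist _ _).trans (leafDist_le p q)).trans_lt
      (lt_top_iff_ne_top.2 (gEDist_ne_top g _ _))).ne
  filter_upwards [hfin] with n hn x y
  obtain ⟨p, hp, hpx⟩ := hcov x
  obtain ⟨q, hq, hqy⟩ := hcov y
  have hρp : rho (leafOf p : F.LeafSpace g) (leafOf x) ≤ ε :=
    ((rho_le_leafDist _ _).trans (leafDist_le p x)).trans hpx.le
  have hρq : rho (leafOf y : F.LeafSpace g) (leafOf q) ≤ ε := by
    rw [rho_comm]
    exact ((rho_le_leafDist _ _).trans (leafDist_le q y)).trans hqy.le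
  have h1 : warpedEDist g (f n) x p ≤ ε := by
    rw [warpedEDist_comm]
    exact (warpedEDist_le_gEDist (hf n) _ _).trans hpx.le
  have h2 : warpedEDist g (f n) q y ≤ ε := (warpedEDist_le_gEDist (hf n) _ _).trans hqy.le
  calc warpedEDist g (f n) x y
      ≤ warpedEDist g (f n) x p + (warpedEDist g (f n) p q + warpedEDist g (f n) q y) :=
        (warpedEDist_triangle _ _ p _).trans (add_le_add_right (warpedEDist_triangle _ _ q _) _)
    _ ≤ ε + ((ε + (rho (leafOf x : F.LeafSpace g) (leafOf y) + ε) + ε) + ε) := by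
        gcongr
        refine (hn p hp q hq).le.trans ?_
        gcongr
        refine (rho_triangle _ (leafOf x) _).trans ?_
        gcongr
        exact (rho_triangle _ (leafOf y) _).trans (add_le_add_right hρq _)
    _ = rho (leafOf x : F.LeafSpace g) (leafOf y) + 5 * ε := by ring

end Foliation
end UpperBound

end FoliatedGH

end

theorem mainTheorem4
    {E : Type*} [NormedAddCommGroup E] [NormedSpace ℝ E] [FiniteDimensional ℝ E]
    {H : Type*} [TopologicalSpace H] (I : ModelWithCorners ℝ E H)
    {E₁ : Type*} [NormedAddCommGroup E₁] [NormedSpace ℝ E₁] [FiniteDimensional ℝ E₁]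
    {H₁ : Type*} [TopologicalSpace H₁] (I₁ : ModelWithCorners ℝ E₁ H₁)
    {E₂ : Type*} [NormedAddCommGroup E₂] [NormedSpace ℝ E₂] [FiniteDimensional ℝ E₂]
    {H₂ : Type*} [TopologicalSpace H₂] (I₂ : ModelWithCorners ℝ E₂ H₂)
    {M : Type*} [TopologicalSpace M] [T2Space M] [CompactSpace M] [ConnectedSpace M]
    [ChartedSpace H M] [IsManifold I ∞ M]
    (F : FoliatedGH.Foliation I I₁ I₂ M)
    (g : ContMDiffRiemannianMetric I ∞ E (fun x : M ↦ TangentSpace I x))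
    (G : Set M) (hG : Dense G)
    (f : ℕ → F.WarpingFunction) (hf : ∀ n x, f n x < 1)
    (hfG : ∀ x ∈ G, Tendsto (fun n ↦ f n x) atTop (𝓝 0)) :
    Tendsto (fun n ↦ GromovHausdorff.toGHSpace (F.Warped g (f n))) atTop
      (𝓝 (GromovHausdorff.toGHSpace (F.HausdorffLeafSpace g))) := by
  rw [Metric.tendsto_atTop]
  intro ε hε
  have hδ : 0 < ENNReal.ofReal (ε / 5) := ENNReal.ofReal_pos.2 (by positivity)
  obtain ⟨N, hN⟩ := eventually_atTop.1
    (FoliatedGH.Foliation.eventually_forall_warpedEDist_le (g := g) hG hf hfG hδ)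
  refine ⟨N, fun n hn ↦ ?_⟩
  let proj : F.Warped g (f n) → F.HausdorffLeafSpace g := fun x ↦
    (FoliatedGH.Foliation.leafOf (x : M) : F.LeafSpace g).toHausdorff
  have hdist : ∀ x y, |dist x y - dist (proj x) (proj y)| ≤ ε := by
    intro x y
    have hlow : edist (proj x) (proj y) ≤ edist x y := by
      rw [FoliatedGH.Foliation.edist_toHausdorff]
      exact FoliatedGH.Foliation.rho_le_warpedEDist (f n) (x : M) y
    have hup : edist x y ≤ edist (proj x) (proj y) + ENNReal.ofReal ε := by
      have h := hN n hn (x : M) y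
      have h5 : 5 * ENNReal.ofReal (ε / 5) = ENNReal.ofReal ε := by
        rw [show (5 : ENNReal) = ENNReal.ofReal 5 by simp, ← ENNReal.ofReal_mul (by norm_num)]
        congr 1
        ring
      rw [h5] at h
      rw [FoliatedGH.Foliation.edist_toHausdorff]
      exact h
    rw [edist_dist, edist_dist, ENNReal.ofReal_le_ofReal_iff dist_nonneg] at hlow
    rw [edist_dist, edist_dist, ← ENNReal.ofReal_add dist_nonneg hε.le,
      ENNReal.ofReal_le_ofReal_iff (add_nonneg dist_nonneg hε.le)] at hup
    rw [abs_of_nonneg (sub_nonneg.2 hlow)]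
    linarith
  have h := GromovHausdorff.ghDist_le_of_approx_subsets (X := F.Warped g (f n))
    (Y := F.HausdorffLeafSpace g) (s := univ) (fun x ↦ proj x) (ε₁ := 0)
    (ε₂ := ε) (ε₃ := 0) (fun x ↦ ⟨x, mem_univ x, (dist_self x).le⟩)
    (fun z ↦ by
      obtain ⟨L, rfl⟩ := FoliatedGH.Foliation.toHausdorff_surjective F g z
      obtain ⟨x, rfl⟩ := FoliatedGH.Foliation.leafOf_surjective L
      exact ⟨⟨(x : F.Warped g (f n)), mem_univ _⟩, (dist_self _).le⟩)
    (fun x y ↦ hdist x y)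
  calc dist (GromovHausdorff.toGHSpace (F.Warped g (f n)))
        (GromovHausdorff.toGHSpace (F.HausdorffLeafSpace g)) ≤ 0 + ε / 2 + 0 := h
    _ < ε := by linarith
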